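/- Words are finite sequences of symbols over finite alphabets. For a language $L\subseteq X^*$, its downward closure $L{\downarrow}$ is the set of all $u\in X^*$ that are (not necessarily contiguous) subwords of some $v\in L$, and its Parikh image $\Psi(L)=\{\Psi(w)\mid w\in L\}$ consists of the multisets $\Psi(w)\colon x\mapsto |w|_x$. Let $\mathcal{C}$ be a class of languages whose members are represented by finite objects (such as grammars or automata). - $\mathcal{C}$ is a full trio if it is effectively closed under rational transductions: given a representation of $L\in\mathcal{C}$ and a finite-state transducer generating $T\subseteq X^*\times Y^*$, one can compute a representation in $\mathcal{C}$ of $TL=\{v\mid \exists u\in L\colon (u,v)\in T\}\in\mathcal{C}$. - $\mathcal{C}$ has effectively semilinear Parikh images if, given a representation of $L\in\mathcal{C}$, one can compute multisets describing $\Psi(L)$ as a finite union of linear sets, i.e. sets of the form $\{\mu_0+x_1\mu_1+\cdots+x_n\mu_n\mid x_1,\ldots,x_n\in\mathbb{N}\}$. - Downward closures are computable for $\mathcal{C}$ if, given a representation of $L\in\mathcal{C}$, one can compute a finite automaton accepting $L{\downarrow}$. Corollary. For every full trio with effectively semilinear Parikh images, downward closures are computable. -/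

import Mathlib

namespace DownwardClosures

/-!
Alphabets are finite subsets of the fixed supply `ℕ` of symbols, and words are lists of symbols.
States of automata and transducers are natural numbers as well. A machine is given by its finite
list of edges, its initial state and its finite list of final states, so its state set and its
alphabets are the finite sets of the states and symbols that occur in these data.
-/

/-- A finite automaton; the edge `(p, w, q)` leads from `p` to `q` and reads the word `w`. -/
structure Automaton where
  edges : List (ℕ × List ℕ × ℕ)
  start : ℕ
  final : List ℕ

/-- A finite-state transducer; the edge `(p, u, v, q)` leads from `p` to `q`, reads the word `u`
and outputs the word `v`. -/
structure Transducer where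
  edges : List (ℕ × List ℕ × List ℕ × ℕ)
  start : ℕ
  final : List ℕ

/-- An automaton as the triple of its data. -/
def Automaton.equivProd : Automaton ≃ List (ℕ × List ℕ × ℕ) × ℕ × List ℕ where
  toFun A := (A.edges, A.start, A.final)
  invFun x := ⟨x.1, x.2.1, x.2.2⟩
  left_inv _ := rfl
  right_inv _ := rfl

/-- A transducer as the triple of its data. -/
def Transducer.equivProd :
    Transducer ≃ List (ℕ × List ℕ × List ℕ × ℕ) × ℕ × List ℕ where
  toFun A := (A.edges, A.start, A.final)
  invFun x := ⟨x.1, x.2.1, x.2.2⟩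
  left_inv _ := rfl
  right_inv _ := rfl

/-- The standard coding of automata, through the triple of their data. -/
instance : Primcodable Automaton := Primcodable.ofEquiv _ Automaton.equivProd

/-- The standard coding of transducers, through the triple of their data. -/
instance : Primcodable Transducer := Primcodable.ofEquiv _ Transducer.equivProd

/-- `A.Path p w q`: there is a path from `p` to `q` labelled `w`. -/
inductive Automaton.Path (A : Automaton) : ℕ → List ℕ → ℕ → Prop
  | nil (p : ℕ) : Automaton.Path A p [] p
  | cons {p q r : ℕ} {u w : List ℕ} (he : (p, u, q) ∈ A.edges) (hp : Automaton.Path A q w r) :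
      Automaton.Path A p (u ++ w) r

/-- The language accepted by an automaton. -/
def Automaton.language (A : Automaton) : Language ℕ :=
  {w | ∃ f ∈ A.final, A.Path A.start w f}

/-- `A.Path p u v q`: there is a path from `p` to `q` that reads `u` and outputs `v`. -/
inductive Transducer.Path (A : Transducer) : ℕ → List ℕ → List ℕ → ℕ → Prop
  | nil (p : ℕ) : Transducer.Path A p [] [] p
  | cons {p q r : ℕ} {u v u' v' : List ℕ} (he : (p, u, v, q) ∈ A.edges)
      (hp : Transducer.Path A q u' v' r) : Transducer.Path A p (u ++ u') (v ++ v') r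

/-- The transduction generated by a transducer; these are the rational transductions. -/
def Transducer.transduction (A : Transducer) : Set (List ℕ × List ℕ) :=
  {x | ∃ f ∈ A.final, A.Path A.start x.1 x.2 f}

/-- The image `T L` of a language under a transduction. -/
def applyTransduction (T : Set (List ℕ × List ℕ)) (L : Language ℕ) : Language ℕ :=
  {v | ∃ u ∈ L, (u, v) ∈ T}

/-- The downward closure of a language: all (scattered) subwords of its members. -/
def downwardClosure (L : Language ℕ) : Language ℕ :=
  {u | ∃ v ∈ L, u.Sublist v}

/-- The Parikh image of a language. The Parikh map sends a word to the multiset of its symbols. -/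
def parikhImage (L : Language ℕ) : Set (Multiset ℕ) :=
  {μ | ∃ w ∈ L, (w : Multiset ℕ) = μ}

/-- A representation of a linear set: its base and its period elements. A multiset is written down
as a word with this Parikh image. -/
abbrev LinearCode : Type := List ℕ × List (List ℕ)

/-- The linear set with base `μ₀` and period elements `μ₁, …, μₙ`, that is, the set of all
`μ₀ + x₁ • μ₁ + ⋯ + xₙ • μₙ` with natural numbers `x₁, …, xₙ`. -/
def LinearCode.toSet (c : LinearCode) : Set (Multiset ℕ) :=
  {μ | ∃ x : Fin c.2.length → ℕ,
    μ = (c.1 : Multiset ℕ) + ∑ i, x i • ((c.2.get i : List ℕ) : Multiset ℕ)}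

/-- A representation of a semilinear set: a finite list of linear sets. -/
abbrev SemilinearCode : Type := List LinearCode

/-- The union of the listed linear sets. -/
def SemilinearCode.toSet (s : SemilinearCode) : Set (Multiset ℕ) :=
  {μ | ∃ c ∈ s, μ ∈ LinearCode.toSet c}

/-- There is an algorithm that, given any input `a ∈ D`, halts with some `b` such that `P a b`.
On inputs outside `D` nothing is required. -/
def ComputableOn {α β : Type} [Primcodable α] [Primcodable β] (D : Set α) (P : α → β → Prop) :
    Prop :=
  ∃ f : α →. β, Partrec f ∧ ∀ a ∈ D, ∃ b ∈ f a, P a b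

/-- A class of languages over finite alphabets, together with the way its members are represented
by finite objects. These objects (grammars, automata, …) are coded by natural numbers, and
`reps` is the set of codes. It may be undecidable whether a number belongs to `reps`, and the same
language may have many representations. The values of `lang` outside `reps` play no role. -/
structure LanguageClass where
  reps : Set ℕ
  lang : ℕ → Language ℕ
  finite_alphabet : ∀ c ∈ reps, ∃ X : Finset ℕ, ∀ w ∈ lang c, ∀ a ∈ w, a ∈ X

/-- A full trio: a class that is effectively closed under rational transductions, i.e. from a
representation of `L` in the class and a transducer for `T` one can compute a representation of
`T L` in the class. -/
def LanguageClass.IsFullTrio (C : LanguageClass) : Prop :=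
  ComputableOn {x : ℕ × Transducer | x.1 ∈ C.reps} fun x (d : ℕ) =>
    d ∈ C.reps ∧ C.lang d = applyTransduction x.2.transduction (C.lang x.1)

/-- Effectively semilinear Parikh images: from a representation of `L` in the class one can compute
a semilinear representation of the Parikh image of `L`. -/
def LanguageClass.EffectivelySemilinear (C : LanguageClass) : Prop :=
  ComputableOn C.reps fun c (s : SemilinearCode) => s.toSet = parikhImage (C.lang c)

/-- Downward closures are computable: from a representation of `L` in the class one can compute a
finite automaton for the downward closure of `L`. -/
def LanguageClass.DownwardClosuresComputable (C : LanguageClass) : Prop :=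
  ComputableOn C.reps fun c (A : Automaton) => A.language = downwardClosure (C.lang c)

end DownwardClosures

/-! Over a finite alphabet, Higman's lemma makes every downward closed language the set of words
avoiding finitely many subwords, and hence a finite union of ideals, each a product of atoms `{a,
ε}` and `Y*` (`exists_patterns`). The algorithm searches for such a union equal to the downward
closure. The search terminates because a solution exists, so it remains to decide equality. A
transducer that deletes letters first yields a representation of the downward closure within the
class.

That the language lies in a given union is an emptiness question: apply a transducer that reads
exactly the words outside the union. Emptiness is visible in a semilinear representation.

For the converse inclusion of an ideal, the words that repeat each block `Y` many times are cofinal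
in the ideal. A transducer reads such words and counts the repetitions of each star. The ideal is
included iff all counts can be made large simultaneously (`Pattern.forall_mem_iff_unbounded`). In
semilinear terms, some linear set has, for each star, a period containing its symbol
(`SemilinearCode.unbounded_iff`). The quotient automaton of the union found is the output. -/

namespace DownwardClosures

/-! ### Algorithms that are correct under a promise -/

section Algorithms

variable {α β γ : Type} [Primcodable α] [Primcodable β] [Primcodable γ]

/-- The predicate `p` is decidable under the promise that the input belongs to `D`. -/
def DecidableOn (D : Set α) (p : α → Prop) : Prop :=
  ComputableOn D fun a (b : Bool) => b = true ↔ p a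

theorem ComputableOn.mono {D E : Set α} {P Q : α → β → Prop} (h : ComputableOn D P) (hE : E ⊆ D)
    (hPQ : ∀ a ∈ E, ∀ b, P a b → Q a b) : ComputableOn E Q := by
  obtain ⟨f, hf, h⟩ := h
  refine ⟨f, hf, fun a ha => ?_⟩
  obtain ⟨b, hb, hP⟩ := h a (hE ha)
  exact ⟨b, hb, hPQ a ha b hP⟩

theorem ComputableOn.comp {D : Set α} {E : Set β} {P : β → γ → Prop} {g : α → β}
    (h : ComputableOn E P) (hg : Computable g) (hD : ∀ a ∈ D, g a ∈ E) :
    ComputableOn D fun a => P (g a) := by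
  obtain ⟨f, hf, h⟩ := h
  exact ⟨fun a => f (g a), hf.comp hg, fun a ha => h _ (hD a ha)⟩

theorem ComputableOn.of_computable {g : α → β} (hg : Computable g) (D : Set α) :
    ComputableOn D fun a b => b = g a :=
  ⟨fun a => Part.some (g a), hg, fun a _ => ⟨g a, Part.mem_some _, rfl⟩⟩

/-- The second algorithm only ever sees correct outputs of the first, so its promise may include
`P`. -/
theorem ComputableOn.bind {D : Set α} {P : α → β → Prop} {Q : α × β → γ → Prop} {R : α → γ → Prop}
    (h : ComputableOn D P) (h' : ComputableOn {x : α × β | x.1 ∈ D ∧ P x.1 x.2} Q)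
    (hR : ∀ a ∈ D, ∀ b c, P a b → Q (a, b) c → R a c) : ComputableOn D R := by
  obtain ⟨f, hf, h⟩ := h
  obtain ⟨g, hg, h'⟩ := h'
  refine ⟨fun a => (f a).bind fun b => g (a, b), hf.bind hg.to₂, fun a ha => ?_⟩
  obtain ⟨b, hb, hP⟩ := h a ha
  obtain ⟨c, hc, hQ⟩ := h' (a, b) ⟨ha, hP⟩
  exact ⟨c, Part.mem_bind hb hc, hR a ha b c hP hQ⟩

/-- The output of an algorithm may be postprocessed by a computable function that also has access
to the input. -/
theorem ComputableOn.map {D : Set α} {P : α → β → Prop} {R : α → γ → Prop} {g : α × β → γ}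
    (h : ComputableOn D P) (hg : Computable g)
    (hR : ∀ a ∈ D, ∀ b, P a b → R a (g (a, b))) : ComputableOn D R :=
  h.bind (.of_computable hg _) fun a ha b _ hP hc => hc ▸ hR a ha b hP

theorem DecidableOn.and {D : Set α} {p q : α → Prop} (hp : DecidableOn D p)
    (hq : DecidableOn D q) : DecidableOn D fun a => p a ∧ q a := by
  refine ComputableOn.bind (Q := fun (x : α × Bool) (b : Bool) => b = true ↔ x.2 = true ∧ q x.1)
    hp ?_ ?_
  · refine ComputableOn.map (g := fun x : (α × Bool) × Bool => x.1.2 && x.2)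
      (hq.comp (E := D) (g := Prod.fst) Computable.fst fun x hx => hx.1)
      (Primrec.and.comp (Primrec.snd.comp Primrec.fst) Primrec.snd).to_comp ?_
    intro x _ b hb
    simp [hb]
  · intro a _ b c hb hc
    rw [hc, hb]

/-- The promise concerns only the first component, so every single test terminates and the tests can
be run one index after another, accumulating the conjunction. -/
theorem DecidableOn.forall_mem_list {D : Set α} {p : α → β → Prop}
    (hp : DecidableOn {x : α × β | x.1 ∈ D} fun x => p x.1 x.2) :
    DecidableOn {x : α × List β | x.1 ∈ D} fun x => ∀ b ∈ x.2, p x.1 b := by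
  obtain ⟨t, ht, h⟩ := hp
  let g : (α × List β) → ℕ × Bool → Part Bool := fun x y =>
    Option.casesOn (x.2[y.1]?) (Part.some y.2) fun b => (t (x.1, b)).map fun r => y.2 && r
  have hg : Partrec₂ g := by
    refine Partrec.optionCasesOn_right
      (Computable.list_getElem?.comp (Computable.snd.comp Computable.fst)
        (Computable.fst.comp Computable.snd)) (Computable.snd.comp Computable.snd) ?_
    refine Partrec.map (ht.comp ((Computable.fst.comp (Computable.fst.comp Computable.fst)).pair
      Computable.snd)) ?_
    exact (Primrec.and.comp (Primrec.snd.comp (Primrec.snd.comp (Primrec.fst.comp Primrec.fst)))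
      Primrec.snd).to_comp
  let F : (α × List β) → ℕ → Part Bool := fun x n =>
    Nat.rec (Part.some true) (fun i r => r.bind fun b => g x (i, b)) n
  refine ⟨fun x => F x x.2.length, Partrec.nat_rec (Computable.list_length.comp Computable.snd)
    (Computable.const true) hg, fun x hx => ?_⟩
  have key : ∀ n, n ≤ x.2.length → ∃ r ∈ F x n, (r = true ↔ ∀ b ∈ x.2.take n, p x.1 b) := by
    intro n
    induction n with
    | zero => exact fun _ => ⟨true, Part.mem_some _, by simp⟩
    | succ n ih =>
      intro hn
      obtain ⟨r, hr, hr'⟩ := ih (by omega)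
      obtain ⟨s, hs, hs'⟩ := h (x.1, x.2[n]) hx
      refine ⟨r && s, Part.mem_bind hr ?_, ?_⟩
      · have : x.2[n]? = some x.2[n] := List.getElem?_eq_getElem _
        simp only [g, this]
        exact Part.mem_map _ hs
      · rw [List.take_succ_eq_append_getElem (by omega), Bool.and_eq_true, hr', hs']
        simp only [List.mem_append, List.mem_singleton]
        exact ⟨fun h b hb => hb.elim (h.1 b) fun e => e ▸ h.2,
          fun h => ⟨fun b hb => h b (.inl hb), h _ (.inr rfl)⟩⟩
  obtain ⟨r, hr, hr'⟩ := key _ le_rfl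
  exact ⟨r, hr, by simpa using hr'⟩

/-- Unbounded search for a solution of a decidable condition. -/
theorem DecidableOn.search {D : Set α} {p : α → β → Prop}
    (hp : DecidableOn {x : α × β | x.1 ∈ D} fun x => p x.1 x.2) (hex : ∀ a ∈ D, ∃ b, p a b) :
    ComputableOn D p := by
  obtain ⟨t, ht, h⟩ := hp
  -- Numbers that code nothing are rejected instead of diverging; otherwise they would block the
  -- search.
  let g : α → ℕ → Part Bool := fun a n =>
    Option.casesOn (Encodable.decode (α := β) n) (Part.some false) fun b => t (a, b)
  have hg : Partrec₂ g :=
    Partrec.optionCasesOn_right (Computable.decode.comp Computable.snd) (Computable.const false)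
      (ht.comp ((Computable.fst.comp Computable.fst).pair Computable.snd))
  refine ⟨fun a => (Nat.rfind (g a)).bind fun n => (Encodable.decode (α := β) n : Part β),
    (Partrec.rfind hg).bind (Partrec.to₂ (Computable.ofOption
      (Computable.decode.comp Computable.snd))), fun a ha => ?_⟩
  have hdom : ∀ n, (g a n).Dom := by
    intro n
    simp only [g]
    cases Encodable.decode (α := β) n with
    | none => trivial
    | some b => exact Part.dom_iff_mem.2 ((h (a, b) ha).imp fun _ => And.left)
  obtain ⟨b, hb⟩ := hex a ha
  have hn : (Nat.rfind (g a)).Dom := by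
    refine Nat.rfind_dom.2 ⟨Encodable.encode b, ?_, fun _ => hdom _⟩
    obtain ⟨r, hr, hr'⟩ := h (a, b) ha
    simpa only [g, Encodable.encodek, hr'.2 hb] using hr
  obtain ⟨n, hn⟩ := Part.dom_iff_mem.1 hn
  have hs := Nat.rfind_spec hn
  cases hd : Encodable.decode (α := β) n with
  | none => simp [g, hd] at hs
  | some c =>
    simp only [g, hd] at hs
    obtain ⟨r, hr, hr'⟩ := h (a, c) ha
    refine ⟨c, Part.mem_bind hn (by simp [hd]), hr'.1 (Part.mem_unique hr hs)⟩

end Algorithms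
-- Ideals of the subword order and their quotient automata
/-- A pattern is a product of atoms, each of which is either an optional letter or the set of all
words over a finite set of letters. Patterns describe the ideals of the subword order. -/
abbrev Pattern : Type := List (ℕ ⊕ List ℕ)

namespace Pattern

/-- `Mem P w`: the word `w` belongs to the ideal described by `P`. -/
def Mem : Pattern → List ℕ → Prop
  | [], w => w = []
  | .inl a :: P, w => Mem P w ∨ ∃ v, w = a :: v ∧ Mem P v
  | .inr Y :: P, w => ∃ u v, w = u ++ v ∧ (∀ a ∈ u, a ∈ Y) ∧ Mem P v

theorem mem_nil : ∀ P : Pattern, Mem P []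
  | [] => rfl
  | .inl _ :: P => .inl (mem_nil P)
  | .inr _ :: P => ⟨[], [], rfl, by simp, mem_nil P⟩

theorem Mem.of_sublist : ∀ {P : Pattern} {v w : List ℕ}, Mem P w → v.Sublist w → Mem P v
  | [], v, w, h, hv => by
    have : w = [] := h
    subst this
    exact List.sublist_nil.1 hv
  | .inl a :: P, v, w, h, hv => by
    rcases h with h | ⟨w, rfl, h⟩
    · exact .inl (h.of_sublist hv)
    · rcases List.sublist_cons_iff.1 hv with hv' | ⟨v', rfl, hv'⟩
      · exact .inl (h.of_sublist hv')
      · exact .inr ⟨v', rfl, h.of_sublist hv'⟩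
  | .inr Y :: P, v, w, h, hv => by
    obtain ⟨x, y, rfl, hx, h⟩ := h
    obtain ⟨v₁, v₂, rfl, h₁, h₂⟩ := List.sublist_append_iff.1 hv
    exact ⟨v₁, v₂, rfl, fun a ha => hx a (h₁.subset ha), h.of_sublist h₂⟩

/-- The quotient of an ideal by a letter: a list with at most one pattern. -/
def step : Pattern → ℕ → List Pattern
  | [], _ => []
  | .inl a :: P, x => if a = x then [P] else step P x
  | .inr Y :: P, x => if x ∈ Y then [.inr Y :: P] else step P x

/-- The first atom that can read `x` may be assumed to read it: by downward closure, any word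
obtained by skipping that atom is also obtained by using it. Hence a quotient is a single ideal or
empty. -/
theorem exists_mem_step (x : ℕ) (w : List ℕ) :
    ∀ P : Pattern, (∃ Q ∈ step P x, Mem Q w) ↔ Mem P (x :: w)
  | [] => by simp [step, Mem]
  | .inl a :: P => by
    have ih := exists_mem_step x w P
    by_cases h : a = x
    · subst h
      simp only [step, if_true, List.mem_singleton, exists_eq_left, Mem, List.cons.injEq,
        true_and, exists_eq_left']
      exact ⟨.inr, fun h => h.elim (fun h => h.of_sublist (List.sublist_cons_self _ _)) id⟩
    · simp only [step, if_neg h, ih, Mem, List.cons.injEq]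
      exact ⟨.inl, fun h' => h'.elim id fun ⟨_, e, _⟩ => absurd e.1.symm h⟩
  | .inr Y :: P => by
    have ih := exists_mem_step x w P
    by_cases h : x ∈ Y
    · simp only [step, if_pos h, List.mem_singleton, exists_eq_left]
      constructor
      · rintro ⟨u, v, rfl, hu, hv⟩
        exact ⟨x :: u, v, rfl, by simpa [h] using hu, hv⟩
      · exact fun h => h.of_sublist (List.sublist_cons_self _ _)
    · simp only [step, if_neg h, ih]
      constructor
      · exact fun h => ⟨[], _, rfl, by simp, h⟩
      · rintro ⟨_ | ⟨y, u⟩, v, e, hu, hv⟩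
        · rwa [e]
        · obtain ⟨rfl, -⟩ := List.cons.inj e
          exact absurd (hu x (by simp)) h

theorem step_eq_nil_or_singleton_tail (x : ℕ) : ∀ P : Pattern, step P x = [] ∨ ∃ Q ∈ P.tails, step P x = [Q]
  | [] => .inl rfl
  | .inl a :: P => by
    unfold step
    split_ifs
    · exact .inr ⟨P, by simp, rfl⟩
    · refine (step_eq_nil_or_singleton_tail x P).imp_right ?_
      rintro ⟨Q, hQ, h⟩
      exact ⟨Q, by simp only [List.mem_tails] at *; exact hQ.trans (List.suffix_cons _ _), h⟩
  | .inr Y :: P => by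
    unfold step
    split_ifs
    · exact .inr ⟨_, by simp, rfl⟩
    · refine (step_eq_nil_or_singleton_tail x P).imp_right ?_
      rintro ⟨Q, hQ, h⟩
      exact ⟨Q, by simp only [List.mem_tails] at *; exact hQ.trans (List.suffix_cons _ _), h⟩

/-- The quotient of a finite union of ideals by a letter. -/
def next (D : List Pattern) (x : ℕ) : List Pattern :=
  D.flatMap fun P => step P x

/-- Every ideal contains the empty word, so acceptance just means that some ideal survives. -/
theorem foldl_next_ne_nil (w : List ℕ) :
    ∀ D : List Pattern, w.foldl next D ≠ [] ↔ ∃ P ∈ D, Mem P w := by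
  induction w with
  | nil =>
    intro D
    simp only [List.foldl_nil, ne_eq, List.eq_nil_iff_forall_not_mem, not_forall, not_not]
    exact exists_congr fun P => by simp [mem_nil]
  | cons x w ih =>
    intro D
    simp only [List.foldl_cons, ih, next, List.mem_flatMap, ← exists_mem_step x w]
    exact ⟨fun ⟨Q, ⟨P, hP, hQ⟩, h⟩ => ⟨P, hP, Q, hQ, h⟩,
      fun ⟨P, hP, Q, hQ, h⟩ => ⟨Q, ⟨P, hP, hQ⟩, h⟩⟩

/-- A finite list that contains all iterated quotients of a finite union of ideals. -/
def states : List Pattern → List (List Pattern)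
  | [] => [[]]
  | P :: D => ([] :: P.tails.map fun Q => [Q]).flatMap fun s => (states D).map fun t => s ++ t

theorem mem_states_self : ∀ D : List Pattern, D ∈ states D
  | [] => by simp [states]
  | P :: D => by
    rw [states, List.mem_flatMap]
    exact ⟨[P], by simp, List.mem_map.2 ⟨D, mem_states_self D, rfl⟩⟩

/-- Quotients act on each pattern separately and leave nothing or one of its suffixes, so reading
letters never leaves this finite list. -/
theorem next_mem_states {x : ℕ} :
    ∀ {D s : List Pattern}, s ∈ states D → next s x ∈ states D
  | [], s, h => by simp_all [states, next]
  | P :: D, s, h => by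
    simp only [states, List.mem_flatMap, List.mem_map] at h ⊢
    obtain ⟨s, hs, t, ht, rfl⟩ := h
    refine ⟨next s x, ?_, next t x, next_mem_states ht, by simp [next]⟩
    simp only [List.mem_cons, List.mem_map] at hs ⊢
    rcases hs with rfl | ⟨Q, hQ, rfl⟩
    · exact .inl rfl
    · rcases step_eq_nil_or_singleton_tail x Q with h | ⟨R, hR, h⟩
      · exact .inl (by simp [next, h])
      · refine .inr ⟨R, ?_, by simp [next, h]⟩
        simp only [List.mem_tails] at *
        exact hR.trans hQ

open Encodable

/-- The edges of the quotient automaton of a finite union of ideals. -/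
def moves (X : List ℕ) (D : List Pattern) : List (ℕ × ℕ × ℕ) :=
  (states D).flatMap fun s => X.map fun x => (encode s, x, encode (next s x))

theorem mem_moves {X : List ℕ} {D : List Pattern} {m : ℕ × ℕ × ℕ} :
    m ∈ moves X D ↔
      ∃ s ∈ states D, ∃ x ∈ X, m = (encode s, x, encode (next s x)) := by
  simp only [moves, List.mem_flatMap, List.mem_map, eq_comm]

/-- The quotient automaton, which accepts the words over `X` in a finite union of ideals. -/
def automaton (X : List ℕ) (D : List Pattern) : Automaton where
  edges := (moves X D).map fun m => (m.1, [m.2.1], m.2.2)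
  start := encode D
  final := ((states D).filter fun s => s ≠ []).map encode

/-- A transducer that reads the words over `X` outside of a finite union of ideals and has no
output. -/
def complementTransducer (X : List ℕ) (D : List Pattern) : Transducer where
  edges := (moves X D).map fun m => (m.1, [m.2.1], [], m.2.2)
  start := encode D
  final := [encode ([] : List Pattern)]

/-- The automaton is deterministic: `encode` is injective, so a state number determines the list of
ideals and the letter determines its successor. -/
theorem automaton_path {X : List ℕ} {D s : List Pattern} {w : List ℕ} {q : ℕ}
    (hs : s ∈ states D) : (automaton X D).Path (encode s) w q ↔
      (∀ a ∈ w, a ∈ X) ∧ q = encode (w.foldl next s) := by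
  constructor
  · intro h
    generalize hp : encode s = p at h
    induction h generalizing s with
    | nil => simp [hp]
    | @cons p r q u w he _ ih =>
      simp only [automaton, List.mem_map, mem_moves] at he
      obtain ⟨_, ⟨t, ht, x, hx, rfl⟩, he⟩ := he
      simp only [Prod.mk.injEq] at he
      obtain ⟨h₁, rfl, h₂⟩ := he
      obtain rfl : s = t := encode_injective (hp.trans h₁.symm)
      obtain ⟨h₃, h₄⟩ := ih (next_mem_states hs) h₂
      refine ⟨?_, h₄⟩
      simpa [hx] using h₃
  · rintro ⟨hw, rfl⟩
    induction w generalizing s with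
    | nil => exact .nil _
    | cons x w ih =>
      refine .cons (u := [x]) ?_ (ih (next_mem_states hs) fun a ha => hw a (by simp [ha]))
      exact List.mem_map.2 ⟨_, mem_moves.2 ⟨s, hs, x, hw x (by simp), rfl⟩, rfl⟩

theorem mem_automaton_language {X : List ℕ} {D : List Pattern} {w : List ℕ} :
    w ∈ (automaton X D).language ↔ (∀ a ∈ w, a ∈ X) ∧ ∃ P ∈ D, Mem P w := by
  rw [← foldl_next_ne_nil]
  have hmem : ∀ w : List ℕ, w.foldl next D ∈ states D := by
    intro w
    induction w using List.reverseRecOn with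
    | nil => exact mem_states_self D
    | append_singleton w x ih =>
      rw [List.foldl_append]
      exact next_mem_states ih
  constructor
  · rintro ⟨q, hq, h⟩
    obtain ⟨hw, rfl⟩ := (automaton_path (mem_states_self D)).1 h
    obtain ⟨s, hs, e⟩ := List.mem_map.1 hq
    rw [← encode_injective e]
    exact ⟨hw, by simpa using (List.mem_filter.1 hs).2⟩
  · rintro ⟨hw, h⟩
    exact ⟨_, List.mem_map.2 ⟨_, List.mem_filter.2 ⟨hmem w, by simpa using h⟩, rfl⟩,
      (automaton_path (mem_states_self D)).2 ⟨hw, rfl⟩⟩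

theorem complementTransducer_path {X : List ℕ} {D s : List Pattern} {w v : List ℕ} {q : ℕ}
    (hs : s ∈ states D) : (complementTransducer X D).Path (encode s) w v q ↔
      v = [] ∧ (∀ a ∈ w, a ∈ X) ∧ q = encode (w.foldl next s) := by
  constructor
  · intro h
    generalize hp : encode s = p at h
    induction h generalizing s with
    | nil => simp [hp]
    | @cons p r q u v w _ he _ ih =>
      simp only [complementTransducer, List.mem_map, mem_moves] at he
      obtain ⟨_, ⟨t, ht, x, hx, rfl⟩, he⟩ := he
      simp only [Prod.mk.injEq] at he
      obtain ⟨h₁, rfl, rfl, h₂⟩ := he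
      obtain rfl : s = t := encode_injective (hp.trans h₁.symm)
      obtain ⟨rfl, h₃, h₄⟩ := ih (next_mem_states hs) h₂
      refine ⟨rfl, ?_, h₄⟩
      simpa [hx] using h₃
  · rintro ⟨rfl, hw, rfl⟩
    induction w generalizing s with
    | nil => exact .nil _
    | cons x w ih =>
      refine .cons (u := [x]) (v := []) ?_
        (ih (next_mem_states hs) fun a ha => hw a (by simp [ha]))
      exact List.mem_map.2 ⟨_, mem_moves.2 ⟨s, hs, x, hw x (by simp), rfl⟩, rfl⟩

/-- Reduces inclusion in a union of ideals to emptiness. The alphabet bound matters, since the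
transducer gets stuck on letters outside `X`. -/
theorem forall_notMem_apply_complementTransducer {X : List ℕ} {D : List Pattern} {L : Language ℕ}
    (hX : ∀ w ∈ L, ∀ a ∈ w, a ∈ X) :
    (∀ v, v ∉ applyTransduction (complementTransducer X D).transduction L) ↔
      ∀ w ∈ L, ∃ P ∈ D, Mem P w := by
  constructor
  · intro h w hw
    by_contra hD
    refine h [] ⟨w, hw, _, List.mem_singleton_self _,
      (complementTransducer_path (mem_states_self D)).2 ⟨rfl, hX w hw, ?_⟩⟩
    rw [← foldl_next_ne_nil, not_not] at hD
    rw [hD]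
  · rintro h v ⟨w, hw, q, hq, hp⟩
    obtain ⟨-, -, rfl⟩ := (complementTransducer_path (mem_states_self D)).1 hp
    exact (foldl_next_ne_nil w D).2 (h w hw) (encode_injective (List.mem_singleton.1 hq))

/-! ### Inclusion of an ideal as simultaneous unboundedness -/

/-- The word of the ideal `P` in which the star at position `i` (counted from the end) contributes
`f i` copies of the word that lists its letters. -/
def spine (f : ℕ → ℕ) : Pattern → List ℕ
  | [] => []
  | .inl a :: P => a :: spine f P
  | .inr Y :: P => (List.replicate (f (P.length + 1)) Y).flatten ++ spine f P

/-- The positions of the stars, counted from the end. -/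
def stars : Pattern → List ℕ
  | [] => []
  | .inl _ :: P => stars P
  | .inr _ :: P => (P.length + 1) :: stars P

theorem mem_spine (f : ℕ → ℕ) : ∀ P : Pattern, Mem P (spine f P)
  | [] => rfl
  | .inl _ :: P => .inr ⟨_, rfl, mem_spine f P⟩
  | .inr _ :: P => ⟨_, _, rfl, fun a ha => by
      obtain ⟨l, hl, ha⟩ := List.mem_flatten.1 ha
      rwa [← List.eq_of_mem_replicate hl], mem_spine f P⟩

theorem sublist_flatten_replicate {Y u : List ℕ} {n : ℕ} (hu : ∀ a ∈ u, a ∈ Y)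
    (hn : u.length ≤ n) : u.Sublist (List.replicate n Y).flatten := by
  induction u generalizing n with
  | nil => exact List.nil_sublist _
  | cons a u ih =>
    obtain ⟨n, rfl⟩ : ∃ m, n = m + 1 := ⟨n - 1, by simp at hn; omega⟩
    rw [List.replicate_succ, List.flatten_cons, ← List.singleton_append]
    exact (List.singleton_sublist.2 (hu a (by simp))).append
      (ih (fun b hb => hu b (by simp [hb])) (by simpa using hn))

/-- Cofinality of the spine words: a block of a star with at most `n` letters embeds into `n` copies
of `Y`, one copy per letter. -/
theorem Mem.sublist_spine {f : ℕ → ℕ} : ∀ {P : Pattern} {w : List ℕ}, Mem P w →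
    (∀ i ∈ stars P, w.length ≤ f i) → w.Sublist (spine f P)
  | [], w, h, _ => by rw [show w = [] from h]; exact List.nil_sublist _
  | .inl a :: P, w, h, hf => by
    rcases h with h | ⟨v, rfl, h⟩
    · exact (h.sublist_spine hf).cons _
    · exact (h.sublist_spine fun i hi => (by simp : v.length ≤ (a :: v).length).trans
        (hf i hi)).cons_cons _
  | .inr Y :: P, w, h, hf => by
    obtain ⟨u, v, rfl, hu, h⟩ := h
    refine (sublist_flatten_replicate hu ?_).append (h.sublist_spine fun i hi => ?_)
    · exact le_trans (by simp) (hf _ List.mem_cons_self)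
    · exact le_trans (by simp) (hf i (List.mem_cons_of_mem _ hi))

theorem spine_congr {f g : ℕ → ℕ} :
    ∀ {P : Pattern}, (∀ i ≤ P.length, f i = g i) → spine f P = spine g P
  | [], _ => rfl
  | .inl a :: P, h => by
    rw [spine, spine, spine_congr fun i hi => h i (hi.trans (by simp))]
  | .inr Y :: P, h => by
    rw [spine, spine, spine_congr fun i hi => h i (hi.trans (by simp)), h _ (by simp)]

/-- The edges of the transducer of a pattern. Its states are the positions, counted from the end,
and traversing a star outputs its position. -/
def edges : Pattern → List (ℕ × List ℕ × List ℕ × ℕ)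
  | [] => []
  | .inl a :: P => (P.length + 1, [a], [], P.length) :: edges P
  | .inr Y :: P => (P.length + 1, [], [], P.length) ::
      (P.length + 1, Y, [P.length + 1], P.length + 1) :: edges P

/-- The transducer of a pattern reads the words `spine f P` and outputs `f i` copies of the symbol
`i` for each star `i`. -/
def transducer (P : Pattern) : Transducer where
  edges := edges P
  start := P.length
  final := [0]

theorem edges_source_le {e : ℕ × List ℕ × List ℕ × ℕ} :
    ∀ {P : Pattern}, e ∈ edges P → e.1 ≤ P.length
  | [], h => by simp [edges] at h
  | .inl a :: P, h => by
    rcases List.mem_cons.1 h with rfl | h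
    · simp
    · exact (edges_source_le h).trans (by simp)
  | .inr Y :: P, h => by
    rcases List.mem_cons.1 h with rfl | h
    · simp
    rcases List.mem_cons.1 h with rfl | h
    · simp
    · exact (edges_source_le h).trans (by simp)

/-- Counting positions from the end makes a state the length of the remaining pattern; atoms further
left only have edges with larger source. -/
theorem mem_edges_of_suffix {P R : Pattern} (hP : P <:+ R) {e : ℕ × List ℕ × List ℕ × ℕ}
    (he : e.1 = P.length) : e ∈ edges R ↔ e ∈ edges P := by
  induction R with
  | nil => rw [List.suffix_nil.1 hP]
  | cons A R ih =>
    rcases List.suffix_cons_iff.1 hP with rfl | hP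
    · rfl
    · rw [← ih hP]
      have := hP.length_le
      have hne : e.1 ≠ R.length + 1 := by omega
      obtain ⟨p, u, v, q⟩ := e
      cases A <;> simp_all [edges]

/-- Runs move towards the end of the pattern, looping only at stars, so the output records how often
each block was read. The bound on the output symbols ensures that later atoms do not disturb the
count of the current star. -/
theorem transducer_path_spine {R : Pattern} {p q : ℕ} {u o : List ℕ}
    (h : (transducer R).Path p u o q) (hq : q = 0) {P : Pattern} (hP : P <:+ R)
    (hp : p = P.length) : u = spine (fun i => o.count i) P ∧ ∀ i ∈ o, i ≤ P.length := by
  induction h generalizing P with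
  | nil p =>
    have : P = [] := List.eq_nil_of_length_eq_zero (by omega)
    subst this
    simp [spine]
  | @cons p q r u v u' v' he _ ih =>
    have he' := (mem_edges_of_suffix (e := (p, u, v, q)) hP hp).1 he
    match P, hp, hP, he' with
    | .inl a :: P, hp, hP, he' =>
      rcases List.mem_cons.1 he' with he' | he'
      · simp only [Prod.mk.injEq] at he'
        obtain ⟨-, rfl, rfl, hq'⟩ := he'
        obtain ⟨rfl, hle⟩ := ih hq ((List.suffix_cons _ _).trans hP) hq'
        exact ⟨rfl, fun i hi => (hle i hi).trans (by simp)⟩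
      · have := edges_source_le he'
        simp at hp this
        omega
    | .inr Y :: P, hp, hP, he' =>
      rcases List.mem_cons.1 he' with he' | he'
      · simp only [Prod.mk.injEq] at he'
        obtain ⟨-, rfl, rfl, hq'⟩ := he'
        obtain ⟨rfl, hle⟩ := ih hq ((List.suffix_cons _ _).trans hP) hq'
        refine ⟨?_, fun i hi => (hle i hi).trans (by simp)⟩
        have : v'.count (P.length + 1) = 0 :=
          List.count_eq_zero.2 fun h => by have := hle _ h; omega
        simp [spine, this]
      rcases List.mem_cons.1 he' with he' | he'
      · simp only [Prod.mk.injEq] at he'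
        obtain ⟨-, rfl, rfl, hq'⟩ := he'
        obtain ⟨rfl, hle⟩ := ih hq hP hq'
        refine ⟨?_, by simpa using hle⟩
        simp only [spine, List.singleton_append, List.count_cons_self, List.replicate_succ,
          List.flatten_cons, List.append_assoc]
        congr 2
        refine spine_congr fun i hi => ?_
        rw [List.count_cons_of_ne (by omega)]
      · have := edges_source_le he'
        simp at hp this
        omega

theorem exists_transducer_path (k : ℕ) {R : Pattern} : ∀ {P : Pattern}, P <:+ R →
    ∃ o, (transducer R).Path P.length (spine (fun _ => k) P) o 0 ∧ ∀ i ∈ stars P, k ≤ o.count i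
  | [], _ => ⟨[], .nil 0, by simp [stars]⟩
  | .inl a :: P, hP => by
    obtain ⟨o, ho, hk⟩ := exists_transducer_path k ((List.suffix_cons _ _).trans hP)
    exact ⟨o, .cons (u := [a]) (v := [])
      ((mem_edges_of_suffix hP rfl).2 (List.mem_cons_self ..)) ho, hk⟩
  | .inr Y :: P, hP => by
    obtain ⟨o, ho, hk⟩ := exists_transducer_path k ((List.suffix_cons _ _).trans hP)
    refine ⟨List.replicate k (P.length + 1) ++ o, ?_, ?_⟩
    -- The number of loops at this star is freed from `k`, which also governs the stars further on
    -- and must stay fixed in the induction.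
    · suffices h : ∀ n, (transducer R).Path (P.length + 1)
          ((List.replicate n Y).flatten ++ spine (fun _ => k) P)
          (List.replicate n (P.length + 1) ++ o) 0 from h k
      intro n
      induction n with
      | zero =>
        exact .cons (u := []) (v := [])
          ((mem_edges_of_suffix hP rfl).2 (List.mem_cons_self ..)) ho
      | succ n ih =>
        rw [List.replicate_succ, List.replicate_succ, List.flatten_cons, List.append_assoc]
        exact .cons (v := [P.length + 1])
          ((mem_edges_of_suffix hP rfl).2 (List.mem_cons_of_mem _ (List.mem_cons_self ..))) ih
    · intro i hi
      rw [List.count_append]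
      rcases List.mem_cons.1 hi with rfl | hi
      · simp
      · exact (hk i hi).trans (Nat.le_add_left _ _)

/-- Inclusion of an ideal in a downward closed language is an instance of simultaneous
unboundedness. -/
theorem forall_mem_iff_unbounded {P : Pattern} {L : Language ℕ}
    (hL : ∀ w ∈ L, ∀ v : List ℕ, v.Sublist w → v ∈ L) : (∀ w, Mem P w → w ∈ L) ↔
      ∀ k : ℕ, ∃ o ∈ applyTransduction (transducer P).transduction L,
        ∀ i ∈ stars P, k ≤ o.count i := by
  constructor
  · intro h k
    obtain ⟨o, ho, hk⟩ := exists_transducer_path k (List.suffix_refl P)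
    exact ⟨o, ⟨_, h _ (mem_spine _ P), 0, List.mem_singleton_self _, ho⟩, hk⟩
  · intro h w hw
    -- With `w.length` copies of every block, `w` embeds into the word read.
    obtain ⟨o, ⟨u, hu, q, hq, hp⟩, hk⟩ := h w.length
    refine hL u hu w ?_
    have hu : u = spine (fun i => o.count i) P :=
      (transducer_path_spine hp (List.mem_singleton.1 hq) (List.suffix_refl P) rfl).1
    rw [hu]
    exact hw.sublist_spine hk

end Pattern

/-! ### Downward closure as a rational transduction -/

/-- A transducer that deletes arbitrary letters of a word over `X`. -/
def deletionTransducer (X : List ℕ) : Transducer where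
  edges := X.flatMap fun x => [(0, [x], [x], 0), (0, [x], [], 0)]
  start := 0
  final := [0]

theorem deletionTransducer_path {X u v : List ℕ} {p q : ℕ}
    (h : (deletionTransducer X).Path p u v q) : v.Sublist u := by
  induction h with
  | nil => exact List.Sublist.refl _
  | cons he _ ih =>
    refine List.Sublist.append ?_ ih
    obtain ⟨x, -, he⟩ := List.mem_flatMap.1 he
    simp only [List.mem_cons, Prod.mk.injEq, List.not_mem_nil, or_false] at he
    rcases he with ⟨-, rfl, rfl, -⟩ | ⟨-, rfl, rfl, -⟩ <;> simp

theorem exists_deletionTransducer_path {X u v : List ℕ} (h : v.Sublist u)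
    (hu : ∀ a ∈ u, a ∈ X) : (deletionTransducer X).Path 0 u v 0 := by
  induction h with
  | slnil => exact .nil 0
  | cons a _ ih =>
    refine .cons (u := [a]) (v := []) (List.mem_flatMap.2 ⟨a, hu a (by simp), by simp⟩)
      (ih fun b hb => hu b (by simp [hb]))
  | cons_cons a _ ih =>
    refine .cons (u := [a]) (v := [a]) (List.mem_flatMap.2 ⟨a, hu a (by simp), by simp⟩)
      (ih fun b hb => hu b (by simp [hb]))

theorem apply_deletionTransducer {X : List ℕ} {L : Language ℕ}
    (hX : ∀ w ∈ L, ∀ a ∈ w, a ∈ X) :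
    applyTransduction (deletionTransducer X).transduction L = downwardClosure L := by
  refine Set.ext fun v => exists_congr fun u => and_congr_right fun hu => ⟨?_, fun h => ?_⟩
  · rintro ⟨_, _, h⟩
    exact deletionTransducer_path h
  · exact ⟨0, List.mem_singleton_self _, exists_deletionTransducer_path h (hX u hu)⟩

/-! ### Decomposition of downward closed languages into ideals -/

/-- Higman's lemma: a set of words over a finite alphabet has a finite basis. -/
theorem exists_finite_basis {X : List ℕ} {S : Set (List ℕ)} (hS : ∀ w ∈ S, ∀ a ∈ w, a ∈ X) :
    ∃ B : List (List ℕ), (∀ b ∈ B, b ∈ S) ∧ ∀ w ∈ S, ∃ b ∈ B, b.Sublist w := by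
  have hX : Set.PartiallyWellOrderedOn {a | a ∈ X} (fun a b : ℕ => a = b) :=
    (List.finite_toSet X).partiallyWellOrderedOn
  have hwqo := (Set.PartiallyWellOrderedOn.partiallyWellOrderedOn_sublistForall₂ _ hX).mono
    (s := S) hS
  have hiff : ∀ v w : List ℕ, List.SublistForall₂ (fun a b : ℕ => a = b) v w ↔ v.Sublist w := by
    intro v w
    simp only [List.sublistForall₂_iff, List.forall₂_eq_eq_eq, exists_eq_left']
  -- The minimal elements form an antichain, hence a finite set, and each word of `S` lies above one
  -- by induction on length.
  let M : Set (List ℕ) := {b ∈ S | ∀ v ∈ S, v.Sublist b → v = b}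
  have hM : M.Finite := by
    refine IsAntichain.finite_of_partiallyWellOrderedOn ?_
      (hwqo.mono fun b (hb : b ∈ M) => hb.1)
    intro a ha b hb hne h
    exact hne (hb.2 a ha.1 ((hiff a b).1 h))
  refine ⟨hM.toFinset.toList, fun b hb => ?_, fun w hw => ?_⟩
  · simp only [Finset.mem_toList, Set.Finite.mem_toFinset] at hb
    exact hb.1
  · induction hn : w.length using Nat.strong_induction_on generalizing w with
    | _ n ih =>
      by_cases hmin : ∀ v ∈ S, v.Sublist w → v = w
      · exact ⟨w, Finset.mem_toList.2 (hM.mem_toFinset.2 ⟨hw, hmin⟩), List.Sublist.refl _⟩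
      · push Not at hmin
        obtain ⟨v, hv, hvw, hne⟩ := hmin
        obtain ⟨b, hb, hbv⟩ := ih v.length
          (hn ▸ lt_of_le_of_ne hvw.length_le fun h => hne (hvw.eq_of_length h)) v hv rfl
        exact ⟨b, hb, hbv.trans hvw⟩

/-- What remains to be avoided after a letter `x` of a word has been read. -/
def dropHead (x : ℕ) : List ℕ → List ℕ
  | [] => []
  | a :: b => if a = x then b else a :: b

theorem length_dropHead_le (x : ℕ) : ∀ b : List ℕ, (dropHead x b).length ≤ b.length
  | [] => le_rfl
  | a :: b => by rw [dropHead]; split_ifs <;> simp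

/-- Greedy matching: when the heads agree, nothing is lost by matching them at once. -/
theorem sublist_cons_iff_dropHead (x : ℕ) (w : List ℕ) :
    ∀ b : List ℕ, b.Sublist (x :: w) ↔ (dropHead x b).Sublist w
  | [] => by simp [dropHead]
  | a :: b => by
    rw [dropHead]
    split_ifs with h
    · subst h
      exact List.cons_sublist_cons
    · rw [List.sublist_cons_iff]
      refine ⟨fun h' => h'.elim id ?_, .inl⟩
      rintro ⟨r, e, -⟩
      exact absurd (List.cons.inj e).1 h

/-- The words over `X` that avoid finitely many given words form a finite union of ideals. -/
theorem exists_patterns_avoid (X : List ℕ) (B : List (List ℕ)) :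
    ∃ D : List Pattern, ∀ w : List ℕ,
      ((∀ a ∈ w, a ∈ X) ∧ ∀ b ∈ B, ¬ b.Sublist w) ↔ ∃ P ∈ D, Pattern.Mem P w := by
  -- The total length of the forbidden words drops whenever a letter is read that begins one of
  -- them.
  induction hn : (B.map List.length).sum using Nat.strong_induction_on generalizing B with
  | _ n ih =>
    by_cases hnil : [] ∈ B
    · exact ⟨[], fun w => by simpa using fun _ => ⟨[], hnil, List.nil_sublist w⟩⟩
    have hlt : ∀ x, (∃ b ∈ B, b.head? = some x) →
        ((B.map (dropHead x)).map List.length).sum < n := by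
      rintro x ⟨b, hb, hx⟩
      rw [← hn, List.map_map]
      refine List.sum_lt_sum _ _ (fun b _ => length_dropHead_le x b) ⟨b, hb, ?_⟩
      cases b with
      | nil => simp at hx
      | cons a b => simp_all [dropHead]
    -- Stated for all letters to permit `choose`; the value is junk for letters that begin no
    -- forbidden word.
    have hrec : ∀ x, ∃ D : List Pattern, (∃ b ∈ B, b.head? = some x) → ∀ w : List ℕ,
        ((∀ a ∈ w, a ∈ X) ∧ ∀ b ∈ B.map (dropHead x), ¬ b.Sublist w) ↔
          ∃ P ∈ D, Pattern.Mem P w := by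
      intro x
      by_cases hx : ∃ b ∈ B, b.head? = some x
      · exact (ih _ (hlt x hx) _ rfl).imp fun _ h _ => h
      · exact ⟨[], fun h => absurd h hx⟩
    choose D hD using hrec
    classical
    -- Letters of `Y` begin no forbidden word, so a prefix over `Y` makes no progress towards one.
    -- An avoiding word is over `Y`, or is `u ++ x :: v` with `u` over `Y`, `x` in `Z` and `v`
    -- avoiding the shortened words.
    let Y := X.filter fun x => ¬ ∃ b ∈ B, b.head? = some x
    let Z := X.filter fun x => ∃ b ∈ B, b.head? = some x
    have hY : ∀ u : List ℕ, (∀ a ∈ u, a ∈ Y) → ∀ v : List ℕ, ∀ b ∈ B,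
        b.Sublist (u ++ v) → b.Sublist v := by
      intro u hu v b hb h
      induction u with
      | nil => exact h
      | cons y u ih =>
        refine ih (fun a ha => hu a (by simp [ha])) ?_
        have hy : b.head? ≠ some y := by
          intro h
          have := (List.mem_filter.1 (hu y (by simp))).2
          simp only [decide_eq_true_eq] at this
          exact this ⟨b, hb, h⟩
        rw [List.cons_append, sublist_cons_iff_dropHead] at h
        cases b with
        | nil => simp
        | cons a b =>
          rwa [dropHead, if_neg (by simpa using hy)] at h
    refine ⟨[.inr Y] :: Z.flatMap fun x => (D x).map fun P => .inr Y :: .inl x :: P,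
      fun w => ?_⟩
    simp only [List.mem_cons, List.mem_flatMap, List.mem_map]
    constructor
    · rintro ⟨hw, hB⟩
      by_cases hsplit : ∀ a ∈ w, a ∈ Y
      · exact ⟨_, .inl rfl, w, [], by simp, hsplit, rfl⟩
      · obtain ⟨u, x, v, rfl, hu, hx⟩ : ∃ u x v, w = u ++ x :: v ∧ (∀ a ∈ u, a ∈ Y) ∧ x ∉ Y := by
          clear hw hB
          induction w with
          | nil => simp at hsplit
          | cons a w ihw =>
            by_cases ha : a ∈ Y
            · obtain ⟨u, x, v, rfl, hu, hx⟩ := ihw (by simpa [ha] using hsplit)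
              exact ⟨a :: u, x, v, rfl, by simpa [ha] using hu, hx⟩
            · exact ⟨[], a, w, rfl, by simp, ha⟩
        have hxX : x ∈ X := hw x (by simp)
        have hxB : ∃ b ∈ B, b.head? = some x := by
          by_contra h
          exact hx (List.mem_filter.2 ⟨hxX, by simpa using h⟩)
        obtain ⟨P, hP, hm⟩ := (hD x hxB v).1 ⟨fun a ha => hw a (by simp [ha]), by
          simp only [List.mem_map]
          rintro _ ⟨b, hb, rfl⟩ h
          refine hB b hb ?_
          exact ((sublist_cons_iff_dropHead x v b).2 h).trans (List.sublist_append_right _ _)⟩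
        exact ⟨_, .inr ⟨x, List.mem_filter.2 ⟨hxX, by simpa using hxB⟩, P, hP, rfl⟩,
          u, x :: v, rfl, hu, .inr ⟨v, rfl, hm⟩⟩
    · rintro ⟨_, rfl | ⟨x, hx, P, hP, rfl⟩, u, v, rfl, hu, hm⟩
      · have : v = [] := hm
        subst this
        refine ⟨fun a ha => (List.mem_filter.1 (hu a (by simpa using ha))).1, fun b hb h => ?_⟩
        have := List.sublist_nil.1 (hY u hu [] b hb h)
        exact hnil (this ▸ hb)
      · have hx' := List.mem_filter.1 hx
        simp only [decide_eq_true_eq] at hx'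
        -- The optional letter `x` may be missing from `v`; adding it only makes avoidance harder,
        -- so the case where it is present suffices.
        obtain ⟨t, ht, hvt⟩ : ∃ t, Pattern.Mem P t ∧ v.Sublist (x :: t) := by
          rcases hm with hm | ⟨t, rfl, hm⟩
          · exact ⟨v, hm, List.sublist_cons_self _ _⟩
          · exact ⟨t, hm, List.Sublist.refl _⟩
        obtain ⟨htX, htB⟩ := (hD x hx'.2 t).2 ⟨P, hP, ht⟩
        refine ⟨fun a ha => ?_, fun b hb h => ?_⟩
        · rcases List.mem_append.1 ha with ha | ha
          · exact (List.mem_filter.1 (hu a ha)).1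
          · rcases List.mem_cons.1 (hvt.subset ha) with rfl | ha
            · exact hx'.1
            · exact htX a ha
        · exact htB _ (List.mem_map_of_mem hb)
            ((sublist_cons_iff_dropHead x t b).1 ((hY u hu v b hb h).trans hvt))

/-- A downward closed language over a finite alphabet is a finite union of ideals. -/
theorem exists_patterns {X : List ℕ} {L : Language ℕ} (hX : ∀ w ∈ L, ∀ a ∈ w, a ∈ X)
    (hL : ∀ w ∈ L, ∀ v : List ℕ, v.Sublist w → v ∈ L) :
    ∃ D : List Pattern, ∀ w, w ∈ L ↔ ∃ P ∈ D, Pattern.Mem P w := by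
  obtain ⟨B, hBS, hB⟩ := exists_finite_basis (X := X)
    (S := {w : List ℕ | (∀ a ∈ w, a ∈ X) ∧ w ∉ L}) fun w hw => hw.1
  obtain ⟨D, hD⟩ := exists_patterns_avoid X B
  refine ⟨D, fun w => (Iff.trans ?_ (hD w))⟩
  constructor
  · exact fun hw => ⟨hX w hw, fun b hb h => (hBS b hb).2 (hL w hw b h)⟩
  · rintro ⟨hw, h⟩
    by_contra hwL
    obtain ⟨b, hb, hs⟩ := hB w ⟨hw, hwL⟩
    exact h b hb hs

/-! ### Reading emptiness, alphabet and unboundedness off a semilinear representation -/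

section Semilinear

theorem LinearCode.base_mem (c : LinearCode) : (c.1 : Multiset ℕ) ∈ c.toSet :=
  ⟨fun _ => 0, by simp⟩

/-- A linear set is never empty, since it contains its base; emptiness is therefore syntactic. -/
theorem SemilinearCode.eq_nil_iff {s : SemilinearCode} {L : Language ℕ}
    (hs : s.toSet = parikhImage L) : s = [] ↔ ∀ v, v ∉ L := by
  constructor
  · rintro rfl v hv
    have : (v : Multiset ℕ) ∈ SemilinearCode.toSet [] := hs ▸ ⟨v, hv, rfl⟩
    obtain ⟨c, hc, -⟩ := this
    simp at hc
  · intro h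
    refine List.eq_nil_iff_forall_not_mem.2 fun c hc => ?_
    have : (c.1 : Multiset ℕ) ∈ parikhImage L := hs ▸ ⟨c, hc, LinearCode.base_mem c⟩
    obtain ⟨w, hw, -⟩ := this
    exact h w hw

/-- The symbols that occur in a semilinear representation. -/
def SemilinearCode.letters (s : SemilinearCode) : List ℕ :=
  s.flatMap fun c => c.1 ++ c.2.flatten

theorem SemilinearCode.mem_letters {s : SemilinearCode} {L : Language ℕ}
    (hs : s.toSet = parikhImage L) : ∀ w ∈ L, ∀ a ∈ w, a ∈ s.letters := by
  intro w hw a ha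
  have : (w : Multiset ℕ) ∈ s.toSet := hs ▸ ⟨w, hw, rfl⟩
  obtain ⟨c, hc, x, hx⟩ := this
  have ha' : a ∈ (w : Multiset ℕ) := ha
  rw [hx, Multiset.mem_add, Multiset.mem_sum] at ha'
  refine List.mem_flatMap.2 ⟨c, hc, List.mem_append.2 (ha'.imp (fun h => h) ?_)⟩
  rintro ⟨j, -, hj⟩
  exact List.mem_flatten.2 ⟨c.2.get j, List.get_mem _ _, Multiset.mem_of_mem_nsmul hj⟩

/-- Some linear set of the representation contains vectors that are arbitrarily large in all
coordinates from `I` simultaneously. -/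
def SemilinearCode.Unbounded (s : SemilinearCode) (I : List ℕ) : Prop :=
  ∃ c ∈ s, ∀ i ∈ I, ∃ p ∈ c.2, i ∈ p

theorem LinearCode.le_count_of_mem_period {c : LinearCode} {k i : ℕ} {p : List ℕ} (hp : p ∈ c.2)
    (hi : i ∈ p) : k ≤ Multiset.count i
      ((c.1 : Multiset ℕ) + ∑ j, k • ((c.2.get j : List ℕ) : Multiset ℕ)) := by
  obtain ⟨j, rfl⟩ := List.get_of_mem hp
  rw [Multiset.count_add, Multiset.count_sum']
  refine le_trans ?_ (Nat.le_add_left _ _)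
  refine le_trans ?_ (Finset.single_le_sum (fun _ _ => Nat.zero_le _) (Finset.mem_univ j))
  rw [Multiset.count_nsmul]
  exact Nat.le_mul_of_pos_right _ (Multiset.count_pos.2 hi)

theorem LinearCode.count_of_forall_notMem_period {c : LinearCode} {i : ℕ} {μ : Multiset ℕ}
    (hμ : μ ∈ c.toSet) (hi : ∀ p ∈ c.2, i ∉ p) : μ.count i = c.1.count i := by
  obtain ⟨x, rfl⟩ := hμ
  rw [Multiset.count_add, Multiset.count_sum', Finset.sum_eq_zero, add_zero, Multiset.coe_count]
  intro j _
  rw [Multiset.count_nsmul, Multiset.coe_count,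
    List.count_eq_zero.2 (hi _ (List.get_mem _ _)), mul_zero]

/-- If every coordinate of `I` occurs in a period, setting all coefficients to `k` makes them all
large at once. A coordinate that occurs in no period is frozen at its value in the base. -/
theorem SemilinearCode.unbounded_iff {s : SemilinearCode} {I : List ℕ} {L : Language ℕ}
    (hs : s.toSet = parikhImage L) :
    s.Unbounded I ↔ ∀ k : ℕ, ∃ o ∈ L, ∀ i ∈ I, k ≤ o.count i := by
  constructor
  · rintro ⟨c, hc, h⟩ k
    have : (c.1 : Multiset ℕ) + ∑ j, k • ((c.2.get j : List ℕ) : Multiset ℕ) ∈ parikhImage L :=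
      hs ▸ ⟨c, hc, fun _ => k, rfl⟩
    obtain ⟨o, ho, e⟩ := this
    refine ⟨o, ho, fun i hi => ?_⟩
    obtain ⟨p, hp, hip⟩ := h i hi
    rw [← Multiset.coe_count, e]
    exact LinearCode.le_count_of_mem_period hp hip
  · intro h
    -- This bound exceeds every symbol count in every base, whichever linear set `o` falls into.
    obtain ⟨o, ho, hk⟩ := h ((s.map fun c => c.1.length).sum + 1)
    have : (o : Multiset ℕ) ∈ s.toSet := hs ▸ ⟨o, ho, rfl⟩
    obtain ⟨c, hc, hoc⟩ := this
    refine ⟨c, hc, fun i hi => ?_⟩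
    by_contra hp
    push Not at hp
    have h₁ := LinearCode.count_of_forall_notMem_period hoc hp
    rw [Multiset.coe_count] at h₁
    have h₂ : c.1.count i ≤ c.1.length := List.count_le_length
    have h₃ := List.le_sum_of_mem (List.mem_map_of_mem (f := fun c : LinearCode => c.1.length) hc)
    have h₄ := hk i hi
    omega

end Semilinear

/-! ### Primitive recursiveness of the constructions -/

section Primrec

open Primrec Encodable

theorem primrec_letters : Primrec SemilinearCode.letters :=
  list_flatMap .id (list_append.comp (fst.comp snd) (list_flatten.comp (snd.comp snd))).to₂

theorem primrecRel_mem : PrimrecRel fun (l : List ℕ) (i : ℕ) => i ∈ l :=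
  (PrimrecRel.exists_mem_list Primrec.eq).of_eq fun l i => by simp

theorem primrecRel_unbounded : PrimrecRel SemilinearCode.Unbounded := by
  have h₁ : PrimrecRel fun (ps : List (List ℕ)) (i : ℕ) => ∃ p ∈ ps, i ∈ p :=
    primrecRel_mem.exists_mem_list
  have h₂ : PrimrecRel fun (i : ℕ) (ps : List (List ℕ)) => ∃ p ∈ ps, i ∈ p :=
    h₁.comp snd fst
  have h₃ : PrimrecRel fun (c : LinearCode) (I : List ℕ) => ∀ i ∈ I, ∃ p ∈ c.2, i ∈ p :=
    h₂.forall_mem_list.comp snd (snd.comp fst)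
  exact h₃.exists_mem_list

theorem primrec_step : Primrec₂ Pattern.step := by
  let h : Pattern × ℕ → (ℕ ⊕ List ℕ) × Pattern × List Pattern → List Pattern := fun a b =>
    Sum.casesOn b.1 (fun y => if y = a.2 then [b.2.1] else b.2.2)
      fun Y => if a.2 ∈ Y then [.inr Y :: b.2.1] else b.2.2
  have hh : Primrec₂ h := by
    have ha : Primrec fun x : ((Pattern × ℕ) × (ℕ ⊕ List ℕ) × Pattern × List Pattern) × ℕ =>
        x.1.1.2 := snd.comp (fst.comp fst)
    have ha' : Primrec fun x : ((Pattern × ℕ) × (ℕ ⊕ List ℕ) × Pattern × List Pattern) × List ℕ =>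
        x.1.1.2 := snd.comp (fst.comp fst)
    refine sumCasesOn (fst.comp snd)
      (Primrec.ite (Primrec.eq.comp snd ha)
        (list_cons.comp (fst.comp (snd.comp (snd.comp fst))) (const []))
        (snd.comp (snd.comp (snd.comp fst)))).to₂
      (Primrec.ite (primrecRel_mem.comp snd ha')
        (list_cons.comp (list_cons.comp (sumInr.comp snd) (fst.comp (snd.comp (snd.comp fst))))
          (const []))
        (snd.comp (snd.comp (snd.comp fst)))).to₂
  refine (list_rec (f := fun a : Pattern × ℕ => a.1) (g := fun _ => ([] : List Pattern))
    fst (const []) hh).of_eq ?_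
  rintro ⟨P, x⟩
  induction P with
  | nil => rfl
  | cons A P ih =>
    cases A <;> simp only [Pattern.step, h] at ih ⊢ <;> rw [ih]

theorem primrec_next : Primrec₂ Pattern.next :=
  list_flatMap fst (primrec_step.comp snd (snd.comp fst)).to₂

theorem primrec_tails : Primrec (List.tails : Pattern → List Pattern) := by
  refine (list_rec (f := fun P : Pattern => P) (g := fun _ => ([[]] : List Pattern))
    (h := fun _ b => (b.1 :: b.2.1) :: b.2.2) .id (const [[]])
    (list_cons.comp (list_cons.comp (fst.comp snd) (fst.comp (snd.comp snd)))
      (snd.comp (snd.comp snd))).to₂).of_eq fun P => ?_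
  induction P with
  | nil => rfl
  | cons A P ih => simpa using ih

theorem primrec_states : Primrec Pattern.states := by
  let h : List Pattern → Pattern × List Pattern × List (List Pattern) → List (List Pattern) :=
    fun _ b => ([] :: b.1.tails.map fun Q => [Q]).flatMap fun s => b.2.2.map fun t => s ++ t
  have hh : Primrec₂ h := by
    refine list_flatMap (list_cons.comp (const [])
      (list_map (primrec_tails.comp (fst.comp snd)) (list_cons.comp snd (const [])).to₂)) ?_
    exact (list_map (snd.comp (snd.comp (snd.comp fst)))
      (list_append.comp (snd.comp fst) snd).to₂).to₂
  refine (list_rec .id (const [[]]) hh).of_eq fun D => ?_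
  induction D with
  | nil => rfl
  | cons P D ih =>
    simp only [Pattern.states, h, id_eq] at ih ⊢
    rw [ih]

theorem primrec_moves : Primrec₂ Pattern.moves := by
  have h : Primrec₂ fun (y : (List ℕ × List Pattern) × List Pattern) (x : ℕ) =>
      (encode y.2, x, encode (Pattern.next y.2 x)) :=
    ((Primrec.encode.comp (snd.comp fst)).pair (snd.pair
      (Primrec.encode.comp (primrec_next.comp (snd.comp fst) snd)))).to₂
  exact list_flatMap (primrec_states.comp snd) (list_map (fst.comp fst) h).to₂

theorem primrec_automaton : Primrec₂ Pattern.automaton := by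
  refine (Primrec.of_equiv_symm (e := Automaton.equivProd)).comp (.pair ?_ (.pair ?_ ?_))
  · exact list_map (primrec_moves.comp fst snd) ((fst.comp snd).pair
      ((list_cons.comp (fst.comp (snd.comp snd)) (const [])).pair (snd.comp (snd.comp snd)))).to₂
  · exact Primrec.encode.comp snd
  · refine list_map ?_ (Primrec.encode.comp snd).to₂
    exact (Primrec.listFilter (Primrec.eq.comp .id (const [])).not).comp (primrec_states.comp snd)

theorem primrec_complementTransducer : Primrec₂ Pattern.complementTransducer := by
  refine (Primrec.of_equiv_symm (e := Transducer.equivProd)).comp (.pair ?_ (.pair ?_ ?_))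
  · exact list_map (primrec_moves.comp fst snd) ((fst.comp snd).pair
      ((list_cons.comp (fst.comp (snd.comp snd)) (const [])).pair
        ((const []).pair (snd.comp (snd.comp snd))))).to₂
  · exact Primrec.encode.comp snd
  · exact const _

theorem primrec_stars : Primrec Pattern.stars := by
  let h : Pattern → (ℕ ⊕ List ℕ) × Pattern × List ℕ → List ℕ := fun _ b =>
    Sum.casesOn b.1 (fun _ => b.2.2) fun _ => (b.2.1.length + 1) :: b.2.2
  have hh : Primrec₂ h :=
    sumCasesOn (fst.comp snd) (snd.comp (snd.comp (snd.comp fst))).to₂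
      (list_cons.comp (succ.comp (list_length.comp (fst.comp (snd.comp (snd.comp fst)))))
        (snd.comp (snd.comp (snd.comp fst)))).to₂
  refine (list_rec .id (const []) hh).of_eq fun P => ?_
  induction P with
  | nil => rfl
  | cons A P ih =>
    cases A <;> simp only [Pattern.stars, h, id_eq] at ih ⊢ <;> rw [ih]

theorem primrec_edges : Primrec Pattern.edges := by
  let h : Pattern → (ℕ ⊕ List ℕ) × Pattern × List (ℕ × List ℕ × List ℕ × ℕ) →
      List (ℕ × List ℕ × List ℕ × ℕ) := fun _ b =>
    Sum.casesOn b.1 (fun a => (b.2.1.length + 1, [a], [], b.2.1.length) :: b.2.2) fun Y =>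
      (b.2.1.length + 1, [], [], b.2.1.length) ::
        (b.2.1.length + 1, Y, [b.2.1.length + 1], b.2.1.length + 1) :: b.2.2
  have hh : Primrec₂ h := by
    refine sumCasesOn (fst.comp snd) ?_ ?_
    · have hl : Primrec fun x : (Pattern × (ℕ ⊕ List ℕ) × Pattern ×
          List (ℕ × List ℕ × List ℕ × ℕ)) × ℕ => x.1.2.2.1.length :=
        list_length.comp (fst.comp (snd.comp (snd.comp fst)))
      exact (list_cons.comp ((succ.comp hl).pair ((list_cons.comp snd (const [])).pair
        ((const []).pair hl))) (snd.comp (snd.comp (snd.comp fst)))).to₂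
    · have hl : Primrec fun x : (Pattern × (ℕ ⊕ List ℕ) × Pattern ×
          List (ℕ × List ℕ × List ℕ × ℕ)) × List ℕ => x.1.2.2.1.length :=
        list_length.comp (fst.comp (snd.comp (snd.comp fst)))
      exact (list_cons.comp ((succ.comp hl).pair ((const []).pair ((const []).pair hl)))
        (list_cons.comp ((succ.comp hl).pair (snd.pair
          ((list_cons.comp (succ.comp hl) (const [])).pair (succ.comp hl))))
          (snd.comp (snd.comp (snd.comp fst))))).to₂
  refine (list_rec .id (const []) hh).of_eq fun P => ?_
  induction P with
  | nil => rfl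
  | cons A P ih =>
    cases A <;> simp only [Pattern.edges, h, id_eq] at ih ⊢ <;> rw [ih]

theorem primrec_transducer : Primrec Pattern.transducer :=
  (Primrec.of_equiv_symm (e := Transducer.equivProd)).comp
    (.pair primrec_edges (.pair list_length (const [0])))

theorem primrec_deletionTransducer : Primrec deletionTransducer := by
  refine (Primrec.of_equiv_symm (e := Transducer.equivProd)).comp
    (.pair (list_flatMap .id ?_) (.pair (const 0) (const [0])))
  have hx : Primrec fun x : List ℕ × ℕ => [x.2] := list_cons.comp snd (const [])
  exact (list_cons.comp ((const 0).pair (hx.pair (hx.pair (const 0))))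
    (list_cons.comp ((const 0).pair (hx.pair ((const []).pair (const 0)))) (const []))).to₂

end Primrec

/-! ### The decision procedures and the search -/

namespace LanguageClass

variable {C : LanguageClass}

theorem decidableOn_image_empty (htrio : C.IsFullTrio) (hsemi : C.EffectivelySemilinear) :
    DecidableOn {x : ℕ × Transducer | x.1 ∈ C.reps} fun x =>
      ∀ v, v ∉ applyTransduction x.2.transduction (C.lang x.1) := by
  refine ComputableOn.bind htrio (Q := fun y s => s.toSet = parikhImage (C.lang y.2))
    (hsemi.comp Computable.snd fun y hy => hy.2.1) (R := fun x (s : SemilinearCode) =>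
      s.toSet = parikhImage (applyTransduction x.2.transduction (C.lang x.1))) ?_ |>.map
      (g := fun y => decide (y.2 = [])) ?_ ?_
  · rintro x - d s ⟨-, hd⟩ hs
    rw [← hd, hs]
  · exact (Primrec.eq.comp Primrec.snd (Primrec.const [])).decide.to_comp
  · intro x _ s hs
    rw [decide_eq_true_eq]
    exact SemilinearCode.eq_nil_iff hs

theorem decidableOn_ideal_subset (htrio : C.IsFullTrio) (hsemi : C.EffectivelySemilinear) :
    DecidableOn {x : ℕ × Pattern | x.1 ∈ C.reps ∧
        ∀ w ∈ C.lang x.1, ∀ v : List ℕ, v.Sublist w → v ∈ C.lang x.1} fun x =>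
      ∀ w, Pattern.Mem x.2 w → w ∈ C.lang x.1 := by
  classical
  have h := ComputableOn.comp (D := {x : ℕ × Pattern | x.1 ∈ C.reps ∧
    ∀ w ∈ C.lang x.1, ∀ v : List ℕ, v.Sublist w → v ∈ C.lang x.1})
    (g := fun x => (x.1, Pattern.transducer x.2)) htrio
    (Computable.fst.pair (primrec_transducer.to_comp.comp Computable.snd)) fun x hx => hx.1
  refine ComputableOn.bind h (Q := fun y s => s.toSet = parikhImage (C.lang y.2))
    (hsemi.comp Computable.snd fun y hy => hy.2.1) (R := fun x (s : SemilinearCode) =>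
      s.toSet = parikhImage
        (applyTransduction (Pattern.transducer x.2).transduction (C.lang x.1))) ?_ |>.map
      (g := fun y => decide (y.2.Unbounded y.1.2.stars)) ?_ ?_
  · rintro x - d s ⟨-, hd⟩ hs
    rw [← hd, hs]
  · exact (primrecRel_unbounded.comp Primrec.snd
      (primrec_stars.comp (Primrec.snd.comp Primrec.fst))).decide.to_comp
  · intro x hx s hs
    rw [decide_eq_true_eq, SemilinearCode.unbounded_iff hs]
    exact (Pattern.forall_mem_iff_unbounded hx.2).symm

/-- The class only promises that some finite alphabet exists; the Parikh image makes one computable.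
-/
theorem computableOn_alphabet (hsemi : C.EffectivelySemilinear) :
    ComputableOn C.reps fun c (X : List ℕ) => ∀ w ∈ C.lang c, ∀ a ∈ w, a ∈ X :=
  ComputableOn.map (g := fun y => SemilinearCode.letters y.2) hsemi
    (primrec_letters.to_comp.comp Computable.snd) fun _ _ _ hs => SemilinearCode.mem_letters hs

/-- From a representation of `L` one can compute an alphabet of `L` and a representation of the
downward closure of `L`. -/
theorem computableOn_downwardClosure (htrio : C.IsFullTrio) (hsemi : C.EffectivelySemilinear) :
    ComputableOn C.reps fun c (y : List ℕ × ℕ) => (∀ w ∈ C.lang c, ∀ a ∈ w, a ∈ y.1) ∧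
      y.2 ∈ C.reps ∧ C.lang y.2 = downwardClosure (C.lang c) := by
  refine ComputableOn.bind (computableOn_alphabet hsemi)
    (ComputableOn.map (g := fun y : (ℕ × List ℕ) × ℕ => (y.1.2, y.2))
      (R := fun x y => y.1 = x.2 ∧ y.2 ∈ C.reps ∧
        C.lang y.2 = applyTransduction (deletionTransducer x.2).transduction (C.lang x.1))
      (ComputableOn.comp (g := fun x : ℕ × List ℕ => (x.1, deletionTransducer x.2)) htrio
        (Computable.fst.pair (primrec_deletionTransducer.to_comp.comp Computable.snd))
        fun x hx => hx.1)
      ((Computable.snd.comp Computable.fst).pair Computable.snd)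
      fun x _ d hd => ⟨rfl, hd⟩) ?_
  rintro c - X ⟨_, d⟩ hX ⟨rfl, hd, h⟩
  exact ⟨hX, hd, h.trans (apply_deletionTransducer hX)⟩

/-- For downward closed members over a known alphabet, one can compute a representation as a finite
union of ideals. -/
theorem computableOn_patterns (htrio : C.IsFullTrio) (hsemi : C.EffectivelySemilinear) :
    ComputableOn {y : List ℕ × ℕ | y.2 ∈ C.reps ∧ (∀ w ∈ C.lang y.2, ∀ a ∈ w, a ∈ y.1) ∧
        ∀ w ∈ C.lang y.2, ∀ v : List ℕ, v.Sublist w → v ∈ C.lang y.2}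
      fun y (D : List Pattern) => (∀ w ∈ C.lang y.2, ∃ P ∈ D, Pattern.Mem P w) ∧
        ∀ P ∈ D, ∀ w, Pattern.Mem P w → w ∈ C.lang y.2 := by
  refine DecidableOn.search (DecidableOn.and ?_ ?_) ?_
  · refine ComputableOn.mono (ComputableOn.comp
      (g := fun x : (List ℕ × ℕ) × List Pattern => (x.1.2, Pattern.complementTransducer x.1.1 x.2))
      (decidableOn_image_empty htrio hsemi) ?_ fun x hx => hx.1) (le_refl _) ?_
    · exact (Computable.snd.comp Computable.fst).pair (primrec_complementTransducer.to_comp.comp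
        (Computable.fst.comp Computable.fst) Computable.snd)
    · rintro x hx b hb
      exact hb.trans (Pattern.forall_notMem_apply_complementTransducer hx.2.1)
  · refine DecidableOn.forall_mem_list
      (p := fun (y : List ℕ × ℕ) P => ∀ w, Pattern.Mem P w → w ∈ C.lang y.2) ?_
    exact ComputableOn.comp (g := fun x : (List ℕ × ℕ) × Pattern => (x.1.2, x.2))
      (decidableOn_ideal_subset htrio hsemi)
      ((Computable.snd.comp Computable.fst).pair Computable.snd) fun x hx => ⟨hx.1, hx.2.2⟩
  -- Termination of the search rests on Higman's lemma.
  · rintro y ⟨-, hX, hL⟩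
    obtain ⟨D, hD⟩ := exists_patterns hX hL
    exact ⟨D, fun w hw => (hD w).1 hw, fun P hP w hw => (hD w).2 ⟨P, hP, hw⟩⟩

end LanguageClass

end DownwardClosures

open DownwardClosures in
theorem mainTheorem3 (C : DownwardClosures.LanguageClass)
    (htrio : C.IsFullTrio) (hsemi : C.EffectivelySemilinear) :
    C.DownwardClosuresComputable := by
  refine ComputableOn.bind (C.computableOn_downwardClosure htrio hsemi)
    (ComputableOn.map (g := fun x : (ℕ × List ℕ × ℕ) × List Pattern =>
        Pattern.automaton x.1.2.1 x.2)
      (R := fun x A => A.language = C.lang x.2.2)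
      (ComputableOn.comp (g := Prod.snd) (C.computableOn_patterns htrio hsemi) Computable.snd
        ?_)
      (primrec_automaton.to_comp.comp (Computable.fst.comp (Computable.snd.comp Computable.fst))
        Computable.snd) ?_) ?_
  · rintro ⟨c, X, d⟩ ⟨-, hX, hd, h⟩
    refine ⟨hd, ?_, ?_⟩
    all_goals simp only [h]
    · rintro v ⟨w, hw, hv⟩ a ha
      exact hX w hw a (hv.subset ha)
    · rintro v ⟨w, hw, hv⟩ u hu
      exact ⟨w, hw, hu.trans hv⟩
  · rintro ⟨c, X, d⟩ ⟨-, hX, hd, h⟩ D ⟨hD, hD'⟩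
    refine Set.ext fun w => Pattern.mem_automaton_language.trans
      ⟨fun ⟨_, P, hP, hw⟩ => hD' P hP w hw, fun hw => ⟨?_, hD w hw⟩⟩
    -- The automaton accepts only words over `X`; this costs nothing, as subwords use no new
    -- letters.
    obtain ⟨v, hv, hwv⟩ : w ∈ downwardClosure (C.lang c) := h ▸ hw
    exact fun a ha => hX v hv a (hwv.subset ha)
  · rintro c - y A ⟨-, -, h⟩ hA
    exact hA.trans h
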